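/- Throughout, $\log$ denotes the logarithm to base $2$. A hypergraph $H$ consists of a finite vertex set $V(H)$ and a set $E(H)$ of subsets of $V(H)$, called edges (no repeated edges); it is $k$-uniform if every edge has exactly $k$ elements. We say that $H$ has an $r$-regular subgraph if there are a set $F\subseteq E(H)$ and a nonempty set $S\subseteq V(H)$ such that every vertex of $S$ belongs to exactly $r$ edges of $F$ and every edge of $F$ is contained in $S$. **Theorem 3.1.** Let $k$ be an integer. There is an integer $n_k$ such that for all integers $r$ and $\ell$ with $k>r\ge 3$ and $\ell=\lceil\log r\rceil$, and all $n\ge n_k$, every $k$-uniform hypergraph $H$ with $n$ vertices and no $r$-regular subgraph satisfies the following. - If $k>2^{\ell-1}+2$, then $$|E(H)|\le \binom{n-1}{k-1}+3\,n^{\,k-1-\frac{1}{2r^2-2}}.$$ - If $k=2^{\ell-1}+2$, then $$|E(H)|\le \binom{n-1}{k-1}+3\,n^{\,k-1}(\log\log n)^{-\frac{1}{4(k-1)}}.$$ -/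

import Mathlib

/-- Every edge of the hypergraph has exactly `k` vertices. -/
def Hypergraph.IsUniformOfSize {α : Type*} (H : Hypergraph α) (k : ℕ) : Prop :=
  ∀ e ∈ H.edgeSet, e.encard = k

/-- The hypergraph has an `r`-regular subgraph: there are a set `F` of edges and a nonempty set
`S` of vertices such that every vertex of `S` lies in exactly `r` of the edges in `F`, and the
edges in `F` cover no vertex outside `S`. -/
def Hypergraph.HasRegularSubgraph {α : Type*} (H : Hypergraph α) (r : ℕ) : Prop :=
  ∃ F : Set (Set α), F ⊆ H.edgeSet ∧ ∃ S : Set α, S ⊆ H.vertexSet ∧ S.Nonempty ∧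
    (∀ x ∈ S, {e ∈ F | x ∈ e}.encard = r) ∧ ∀ e ∈ F, e ⊆ S

/-!
Write `ε = 1 / (2 * r ^ 2 - 2)`. The proof shows `|E(H)| ≤ (n-1 choose k-1) + 3 n ^ (k-1-ε)` for all
`k > r ≥ 3` and large `n`; this is the first bound, and it implies the second because a negative
power of `n` is eventually smaller than any fixed negative power of `log log n`.

Two sources of regular subfamilies are used.

* *Many matchings.* Suppose that all edges meet a vertex set `B`, that all degrees are at most `Δ`,
  and that there are `e` edges. There are at least `(e / 2) ^ m / m!` matchings of size
  `m ≈ e / (2 k Δ)`, and each is a perfect matching of one of few vertex sets: choose `m` vertices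
  in `B` and `(k - 1) m` others. A vertex set with more than `(r - 1) ^ m * m!` perfect matchings
  carries an `r`-regular subfamily, by the argument of the Erdős–Rado sunflower lemma
  (`card_perfectMatchings_le`). Comparing the counts gives
  `e * m ^ (k - 2) ≤ 2 (r - 1) |B| n ^ (k - 1)` when no `r`-regular subfamily exists
  (`card_mul_pow_le`).
* *Two vertices with a large common link.* If `b` and `c` are both completed to edges by every
  member of a dense family `𝓛` of `(k-1)`-sets, repeated Cauchy–Schwarz finds in `𝓛` a subfamily
  with at least `r` members that is closed under complementation in a set `S`
  (`exists_complClosed`). For `r` of its members `f`, the edges `f ∪ {b}` and `(S \ f) ∪ {c}` form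
  an `r`-regular family on `S ∪ {b, c}`.

Let `B γ` be the set of vertices of degree more than `n ^ (k-1-γ)`; it has `O(n ^ γ)` elements. The
first source shows that few edges meet `B γ` but avoid `B γ'` as soon as `2 γ' > γ + 3 ε`. Starting
from the whole vertex set (`γ = 1`) and iterating, `γ` comes down to nearly `3 ε`, so that only
`O(n ^ (k-1-ε))` edges avoid a set `B` of `O(n ^ (17 ε / 5))` vertices. Few edges meet `B` twice. If
`H` has too many edges, then more than `(n-1 choose k-1) + n ^ (k-1-ε)` edges meet `B` exactly once,
so many `(k-1)`-sets outside `B` are completed to an edge by two vertices of `B`, and some pair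
`b, c` in `B` serves so many of them that the second source applies.
-/

namespace RegularSubfamily

open Finset

universe u

/-! ### Perfect matchings and the counting bound -/

section Matchings

variable {α : Type*} [DecidableEq α]

/-- Every vertex of `S` lies in exactly `r` members of `F`, and the members of `F` lie inside `S`.
For `r = 1` and nonempty members this says that `F` is a perfect matching of `S`. -/
def IsRegularOn (F : Finset (Finset α)) (r : ℕ) (S : Finset α) : Prop :=
  (∀ x ∈ S, #{e ∈ F | x ∈ e} = r) ∧ ∀ e ∈ F, e ⊆ S

/-- The analogue of `Hypergraph.HasRegularSubgraph` for finite set families. The ambient vertex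
set plays no role when `r` is positive, as every vertex of `S` is then covered by an edge. -/
def HasRegularSubfamily (E : Finset (Finset α)) (r : ℕ) : Prop :=
  ∃ F ⊆ E, ∃ S : Finset α, S.Nonempty ∧ IsRegularOn F r S

theorem HasRegularSubfamily.mono {E E' : Finset (Finset α)} {r : ℕ} (h : E ⊆ E')
    (hE : HasRegularSubfamily E r) : HasRegularSubfamily E' r :=
  let ⟨F, hF, S, hS⟩ := hE
  ⟨F, hF.trans h, S, hS⟩

theorem IsRegularOn.biUnion {G : Finset (Finset (Finset α))} {S : Finset α}
    (hG : (G : Set (Finset (Finset α))).PairwiseDisjoint id)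
    (h : ∀ M ∈ G, IsRegularOn M 1 S) : IsRegularOn (G.biUnion id) #G S := by
  refine ⟨fun x hx => ?_, fun e he => ?_⟩
  · rw [filter_biUnion, card_biUnion]
    · exact (sum_congr rfl fun M hM => (h M hM).1 x hx).trans (by simp)
    · intro M hM M' hM' hne
      exact (hG hM hM' hne).mono (filter_subset _ _) (filter_subset _ _)
  · obtain ⟨M, hM, he⟩ := mem_biUnion.1 he
    exact (h M hM).2 e he

theorem IsRegularOn.erase {M : Finset (Finset α)} {S e : Finset α} (h : IsRegularOn M 1 S)
    (he : e ∈ M) : IsRegularOn (M.erase e) 1 (S \ e) := by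
  refine ⟨fun x hx => ?_, fun f hf => ?_⟩
  · rw [mem_sdiff] at hx
    rw [← h.1 x hx.1]
    congr 1
    ext f
    simp only [mem_filter, mem_erase]
    constructor
    · rintro ⟨⟨-, h1⟩, h2⟩
      exact ⟨h1, h2⟩
    · rintro ⟨h1, h2⟩
      exact ⟨⟨fun h => hx.2 (h ▸ h2), h1⟩, h2⟩
  · rw [mem_erase] at hf
    intro x hx
    refine mem_sdiff.2 ⟨h.2 f hf.2 hx, fun hxe => hf.1 ?_⟩
    have := card_le_one.1 (h.1 x (h.2 f hf.2 hx)).le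
    exact this f (mem_filter.2 ⟨hf.2, hx⟩) e (mem_filter.2 ⟨he, hxe⟩)

/-- A family with no `r`-regular subfamily has at most `(r - 1) ^ m * m!` perfect matchings of a
given set with `m` edges. Indeed, `r` pairwise disjoint perfect matchings of `S` would form an
`r`-regular family; so all of them hit the at most `(r - 1) * m` edges of a maximal disjoint
collection, and those through a fixed edge `e` are counted by induction on `S \ e`. -/
theorem card_perfectMatchings_le {E : Finset (Finset α)} {r : ℕ} (hr : 1 ≤ r)
    (hreg : ¬ HasRegularSubfamily E r) (hne : ∀ e ∈ E, e.Nonempty) (m : ℕ) :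
    ∀ (S : Finset α) (𝓜 : Finset (Finset (Finset α))),
      (∀ M ∈ 𝓜, M ⊆ E ∧ #M = m ∧ IsRegularOn M 1 S) → #𝓜 ≤ (r - 1) ^ m * m.factorial := by
  induction m with
  | zero =>
    intro S 𝓜 h
    have : 𝓜 ⊆ {∅} := fun M hM => by simpa using (h M hM).2.1
    simpa using card_le_card this
  | succ m ih =>
    intro S 𝓜 h
    classical
    obtain ⟨G, hG, hmax⟩ := exists_max_image
      {G ∈ 𝓜.powerset | ((G : Finset (Finset (Finset α))) : Set (Finset (Finset α))).PairwiseDisjoint id} card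
      ⟨∅, by simp⟩
    simp only [mem_filter, mem_powerset] at hG hmax
    obtain ⟨hG𝓜, hGd⟩ := hG
    by_cases hcard : r ≤ #G
    · exfalso
      obtain ⟨G', hG', hr'⟩ := exists_subset_card_eq hcard
      have hreg' : IsRegularOn (G'.biUnion id) #G' S :=
        IsRegularOn.biUnion (hGd.subset (by exact_mod_cast hG'))
          fun M hM => (h M (hG𝓜 (hG' hM))).2.2
      obtain ⟨M, hM⟩ : G'.Nonempty := card_pos.1 (by omega)
      obtain ⟨hME, hMc, hMS⟩ := h M (hG𝓜 (hG' hM))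
      obtain ⟨e, he⟩ : M.Nonempty := card_pos.1 (by omega)
      refine hreg ⟨_, ?_, S, (hne e (hME he)).mono (hMS.2 e he), hr' ▸ hreg'⟩
      exact biUnion_subset.2 fun M hM => (h M (hG𝓜 (hG' hM))).1
    · set U := G.biUnion id with hU
      have hUc : #U ≤ (r - 1) * (m + 1) := by
        calc #U ≤ ∑ M ∈ G, #M := card_biUnion_le
          _ = #G * (m + 1) := by
            rw [sum_congr rfl fun M hM => (h M (hG𝓜 hM)).2.1]; simp
          _ ≤ _ := Nat.mul_le_mul_right _ (by omega)
      have hhit : 𝓜 ⊆ U.biUnion fun e => {M ∈ 𝓜 | e ∈ M} := by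
        intro M hM
        by_contra hcon
        have hdisj : ∀ e ∈ M, e ∉ U := fun e he heU =>
          hcon (mem_biUnion.2 ⟨e, heU, mem_filter.2 ⟨hM, he⟩⟩)
        have hMG : M ∉ G := by
          intro hMG
          obtain ⟨e, he⟩ : M.Nonempty := card_pos.1 (by rw [(h M hM).2.1]; omega)
          exact hdisj e he (mem_biUnion.2 ⟨M, hMG, he⟩)
        have := hmax (insert M G) ⟨insert_subset hM hG𝓜, by
          rw [coe_insert]
          refine hGd.insert fun M' hM' _ => ?_
          exact disjoint_left.2 fun e he he' => hdisj e he (mem_biUnion.2 ⟨M', hM', he'⟩)⟩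
        rw [card_insert_of_notMem hMG] at this
        omega
      have hfib : ∀ e ∈ U, #{M ∈ 𝓜 | e ∈ M} ≤ (r - 1) ^ m * m.factorial := by
        intro e _
        have hinj : Set.InjOn (fun M : Finset (Finset α) => M.erase e)
            ({M ∈ 𝓜 | e ∈ M} : Finset _) := by
          intro M hM M' hM' heq
          simp only [coe_filter, Set.mem_ofPred_eq] at hM hM'
          rw [← insert_erase hM.2, ← insert_erase hM'.2]
          exact congrArg (insert e) heq
        rw [← card_image_of_injOn hinj]
        refine ih (S \ e) _ fun M hM => ?_
        obtain ⟨M', hM', rfl⟩ := mem_image.1 hM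
        obtain ⟨hM', he⟩ := mem_filter.1 hM'
        obtain ⟨h1, h2, h3⟩ := h M' hM'
        exact ⟨(erase_subset _ _).trans h1, by rw [card_erase_of_mem he, h2]; rfl, h3.erase he⟩
      calc #𝓜 ≤ _ := card_le_card hhit
        _ ≤ #U * ((r - 1) ^ m * m.factorial) := card_biUnion_le_card_mul _ _ _ hfib
        _ ≤ (r - 1) * (m + 1) * ((r - 1) ^ m * m.factorial) := Nat.mul_le_mul_right _ hUc
        _ = _ := by rw [Nat.factorial_succ]; ring

open scoped Classical in
/-- The matchings of size `m` in `E`, as sets of pairwise disjoint edges. -/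
noncomputable def matchings (E : Finset (Finset α)) (m : ℕ) : Finset (Finset (Finset α)) :=
  {M ∈ E.powersetCard m | ((M : Finset (Finset α)) : Set (Finset α)).PairwiseDisjoint id}

omit [DecidableEq α] in
theorem mem_matchings {E M : Finset (Finset α)} {m : ℕ} :
    M ∈ matchings E m ↔ M ⊆ E ∧ #M = m ∧ (M : Set (Finset α)).PairwiseDisjoint id := by
  simp [matchings, and_assoc]

/-- While `2 * (j * k * Δ) ≤ #E`, at least half of the edges extend a given matching of size
`j`. -/
theorem card_mul_card_matchings_le {E : Finset (Finset α)} {k Δ j : ℕ}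
    (hk : ∀ e ∈ E, #e = k) (hk0 : 0 < k) (hΔ : ∀ x, #{e ∈ E | x ∈ e} ≤ Δ)
    (hj : 2 * (j * k * Δ) ≤ #E) :
    #E * #(matchings E j) ≤ 2 * ((j + 1) * #(matchings E (j + 1))) := by
  have hext : ∀ M ∈ matchings E j, #E ≤ 2 * #{e ∈ E | ∀ f ∈ M, Disjoint e f} := by
    intro M hM
    obtain ⟨hME, hMc, -⟩ := mem_matchings.1 hM
    have h1 : #{e ∈ E | ¬ ∀ f ∈ M, Disjoint e f} ≤ j * k * Δ := by
      have : {e ∈ E | ¬ ∀ f ∈ M, Disjoint e f} ⊆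
          (M.biUnion id).biUnion fun x => {e ∈ E | x ∈ e} := by
        intro e he
        rw [mem_filter] at he
        push Not at he
        obtain ⟨heE, f, hf, hef⟩ := he
        obtain ⟨x, hxe, hxf⟩ := not_disjoint_iff.1 hef
        exact mem_biUnion.2 ⟨x, mem_biUnion.2 ⟨f, hf, hxf⟩, mem_filter.2 ⟨heE, hxe⟩⟩
      refine (card_le_card this).trans ((card_biUnion_le_card_mul _ _ _ fun x _ => hΔ x).trans ?_)
      refine Nat.mul_le_mul_right _ ((card_biUnion_le_card_mul _ _ k fun f hf => ?_).trans ?_)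
      · exact (hk f (hME hf)).le
      · rw [hMc]
    have h2 := card_filter_add_card_filter_not (s := E) (fun e => ∀ f ∈ M, Disjoint e f)
    omega
  have hmap : ((matchings E j).sigma fun M => {e ∈ E | ∀ f ∈ M, Disjoint e f}).card ≤
      ((matchings E (j + 1)).sigma fun M => M).card := by
    refine card_le_card_of_injOn (fun p => ⟨insert p.2 p.1, p.2⟩) ?_ ?_
    · rintro ⟨M, e⟩ hp
      simp only [coe_sigma, Set.mem_sigma_iff, mem_coe, mem_filter] at hp ⊢
      obtain ⟨hM, heE, hdis⟩ := hp
      obtain ⟨hME, hMc, hMd⟩ := mem_matchings.1 hM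
      have heM : e ∉ M := fun h => by
        have := disjoint_self.1 (hdis e h)
        have h0 := hk e heE
        rw [this] at h0
        simp at h0
        omega
      refine ⟨mem_matchings.2 ⟨insert_subset heE hME, by rw [card_insert_of_notMem heM, hMc], ?_⟩,
        mem_insert_self _ _⟩
      rw [coe_insert]
      exact hMd.insert fun f hf _ => hdis f hf
    · rintro ⟨M, e⟩ hp ⟨M', e'⟩ hp' heq
      simp only [coe_sigma, Set.mem_sigma_iff, mem_coe, mem_filter] at hp hp'
      have hnot : ∀ {M : Finset (Finset α)} {e}, e ∈ E → (∀ f ∈ M, Disjoint e f) → e ∉ M := by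
        intro M e heE hdis h
        have := disjoint_self.1 (hdis e h)
        have h0 := hk e heE
        rw [this] at h0
        simp at h0
        omega
      simp only [Sigma.mk.injEq, heq_eq_eq] at heq
      obtain ⟨h1, rfl⟩ := heq
      have := congrArg (fun N => N.erase e) h1
      simp only [erase_insert (hnot hp.2.1 hp.2.2), erase_insert (hnot hp'.2.1 hp'.2.2)] at this
      rw [this]
  rw [card_sigma, card_sigma] at hmap
  have h3 : ∑ M ∈ matchings E (j + 1), #M = (j + 1) * #(matchings E (j + 1)) := by
    rw [sum_congr rfl fun M hM => (mem_matchings.1 hM).2.1]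
    simp [mul_comm]
  calc #E * #(matchings E j) = ∑ M ∈ matchings E j, #E := by simp [mul_comm]
    _ ≤ ∑ M ∈ matchings E j, 2 * #{e ∈ E | ∀ f ∈ M, Disjoint e f} := sum_le_sum hext
    _ ≤ _ := by rw [← mul_sum, ← h3]; exact Nat.mul_le_mul_left _ hmap

theorem pow_le_card_matchings {E : Finset (Finset α)} {k Δ m : ℕ}
    (hk : ∀ e ∈ E, #e = k) (hk0 : 0 < k) (hΔ : ∀ x, #{e ∈ E | x ∈ e} ≤ Δ)
    (hm : 2 * (m * k * Δ) ≤ #E) :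
    #E ^ m ≤ 2 ^ m * m.factorial * #(matchings E m) := by
  induction m with
  | zero =>
    have : ∅ ∈ matchings E 0 := mem_matchings.2 (by simp)
    simpa using Finset.card_pos.2 ⟨_, this⟩
  | succ m ih =>
    have hm' : 2 * (m * k * Δ) ≤ #E := le_trans (by gcongr; omega) hm
    have h1 := ih hm'
    have h2 := card_mul_card_matchings_le hk hk0 hΔ hm'
    calc #E ^ (m + 1) = #E ^ m * #E := pow_succ _ _
      _ ≤ 2 ^ m * m.factorial * #(matchings E m) * #E := Nat.mul_le_mul_right _ h1
      _ = 2 ^ m * m.factorial * (#E * #(matchings E m)) := by ring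
      _ ≤ 2 ^ m * m.factorial * (2 * ((m + 1) * #(matchings E (m + 1)))) :=
        Nat.mul_le_mul_left _ h2
      _ = _ := by rw [Nat.factorial_succ]; ring

theorem isRegularOn_one_of_pairwiseDisjoint {M : Finset (Finset α)}
    (hM : (M : Set (Finset α)).PairwiseDisjoint id) : IsRegularOn M 1 (M.biUnion id) := by
  refine ⟨fun x hx => ?_, fun e he => subset_biUnion_of_mem id he⟩
  obtain ⟨e, he, hxe⟩ := mem_biUnion.1 hx
  rw [card_eq_one]
  refine ⟨e, eq_singleton_iff_unique_mem.2 ⟨mem_filter.2 ⟨he, hxe⟩, fun f hf => ?_⟩⟩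
  rw [mem_filter] at hf
  by_contra hne
  exact disjoint_left.1 (hM hf.1 he hne) hf.2 hxe

/-- A matching `M` is sent to the pair formed by one vertex of `B` from each of its edges and the
set of the remaining vertices it covers; matchings in the same fibre are perfect matchings of one
set. -/
theorem card_matchings_le [Nonempty α] {E : Finset (Finset α)} {V B : Finset α} {k r : ℕ}
    (hr : 1 ≤ r)
    (hk : ∀ e ∈ E, #e = k) (hk0 : 0 < k) (hV : ∀ e ∈ E, e ⊆ V)
    (hB : ∀ e ∈ E, (e ∩ B).Nonempty) (hreg : ¬ HasRegularSubfamily E r) (m : ℕ) :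
    #(matchings E m) ≤
      (r - 1) ^ m * m.factorial * ((#B).choose m * (#V).choose ((k - 1) * m)) := by
  choose! b hb using hB
  have hbe : ∀ e ∈ E, b e ∈ e := fun e he => (mem_inter.1 (hb e he)).1
  rw [← card_powersetCard, ← card_powersetCard, ← card_product]
  refine card_le_mul_card_image_of_maps_to
    (f := fun M => (M.image b, M.biUnion id \ M.image b)) ?_ _ ?_
  · intro M hM
    obtain ⟨hME, hMc, hMd⟩ := mem_matchings.1 hM
    have hinj : Set.InjOn b M := by
      intro e he f hf hef
      by_contra hne
      exact disjoint_left.1 (hMd he hf hne) (hbe e (hME he)) (hef ▸ hbe f (hME hf))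
    have hc1 : #(M.image b) = m := by rw [card_image_of_injOn hinj, hMc]
    have hsub : M.image b ⊆ M.biUnion id := by
      intro x hx
      obtain ⟨e, he, rfl⟩ := mem_image.1 hx
      exact mem_biUnion.2 ⟨e, he, hbe e (hME he)⟩
    have hc2 : #(M.biUnion id) = m * k := by
      rw [card_biUnion hMd]
      exact (sum_congr rfl fun e he => hk e (hME he)).trans (by simp [hMc])
    refine mem_product.2 ⟨mem_powersetCard.2 ⟨?_, hc1⟩, mem_powersetCard.2 ⟨?_, ?_⟩⟩
    · intro x hx
      obtain ⟨e, he, rfl⟩ := mem_image.1 hx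
      exact (mem_inter.1 (hb e (hME he))).2
    · exact sdiff_subset.trans (biUnion_subset.2 fun e he => hV e (hME he))
    · rw [card_sdiff_of_subset hsub, hc1, hc2, Nat.sub_mul, one_mul, mul_comm]
  · rintro ⟨A, C⟩ -
    refine card_perfectMatchings_le hr hreg
      (fun e he => card_pos.1 (by rw [hk e he]; exact hk0)) m (A ∪ C) _ fun M hM => ?_
    obtain ⟨hM, hAC⟩ := mem_filter.1 hM
    obtain ⟨hME, hMc, hMd⟩ := mem_matchings.1 hM
    refine ⟨hME, hMc, ?_⟩
    have hsub : M.image b ⊆ M.biUnion id := by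
      intro x hx
      obtain ⟨e, he, rfl⟩ := mem_image.1 hx
      exact mem_biUnion.2 ⟨e, he, hbe e (hME he)⟩
    rw [Prod.mk.injEq] at hAC
    rw [← hAC.1, ← hAC.2, union_sdiff_of_subset hsub]
    exact isRegularOn_one_of_pairwiseDisjoint hMd

/-- The count of matchings of size `m` from below, by the maximum degree, against the count from
above, by the number of vertex sets they can cover. -/
theorem card_mul_pow_le [Nonempty α] {E : Finset (Finset α)} {V B : Finset α} {k r m Δ : ℕ}
    (hr : 1 ≤ r)
    (hk : ∀ e ∈ E, #e = k) (hk2 : 2 ≤ k) (hV : ∀ e ∈ E, e ⊆ V)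
    (hB : ∀ e ∈ E, (e ∩ B).Nonempty) (hreg : ¬ HasRegularSubfamily E r)
    (hΔ : ∀ x, #{e ∈ E | x ∈ e} ≤ Δ) (hm0 : m ≠ 0) (hm : 2 * (m * k * Δ) ≤ #E) :
    #E * m ^ (k - 2) ≤ 2 * (r - 1) * #B * #V ^ (k - 1) := by
  have h1 := pow_le_card_matchings hk (by omega) hΔ hm
  have h2 := card_matchings_le hr hk (by omega) hV hB hreg m
  set q := (k - 1) * m with hq
  have hb : m.factorial * (#B).choose m ≤ #B ^ m := by
    rw [← Nat.descFactorial_eq_factorial_mul_choose]; exact Nat.descFactorial_le_pow _ _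
  have hv : q.factorial * (#V).choose q ≤ #V ^ q := by
    rw [← Nat.descFactorial_eq_factorial_mul_choose]; exact Nat.descFactorial_le_pow _ _
  -- The `(k - 2) * m` factors of `q! / m!` all exceed `m`.
  have hf : m.factorial * m ^ ((k - 2) * m) ≤ q.factorial := by
    have : q = m + (k - 2) * m := by
      obtain ⟨t, rfl⟩ := Nat.exists_eq_add_of_le hk2
      rw [hq, show 2 + t - 1 = t + 1 by omega, show 2 + t - 2 = t by omega]; ring
    rw [this]
    exact le_trans (by gcongr; omega) (Nat.factorial_mul_pow_le_factorial)
  have key : m.factorial * (#E * m ^ (k - 2)) ^ m ≤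
      m.factorial * (2 * (r - 1) * #B * #V ^ (k - 1)) ^ m := by
    calc m.factorial * (#E * m ^ (k - 2)) ^ m
        = #E ^ m * (m.factorial * m ^ ((k - 2) * m)) := by rw [mul_pow, ← pow_mul]; ring
      _ ≤ (2 ^ m * m.factorial * ((r - 1) ^ m * m.factorial *
            ((#B).choose m * (#V).choose q))) * q.factorial :=
          Nat.mul_le_mul (h1.trans (Nat.mul_le_mul_left _ h2)) hf
      _ = 2 ^ m * (r - 1) ^ m * m.factorial * (m.factorial * (#B).choose m) *
            (q.factorial * (#V).choose q) := by ring
      _ ≤ 2 ^ m * (r - 1) ^ m * m.factorial * #B ^ m * #V ^ q := by gcongr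
      _ = _ := by rw [hq, mul_pow, mul_pow, mul_pow, ← pow_mul]; ring
  exact (Nat.pow_le_pow_iff_left hm0).1 (Nat.le_of_mul_le_mul_left key (Nat.factorial_pos m))

end Matchings

/-! ### Common links and complement-closed families -/

section Boxes

variable {α : Type*} [DecidableEq α]

/-- A `(k - 1)`-set completed to an edge by `c` vertices of `B` accounts for `c ≤ 1 + (c ^ 2 - c)`
edges, and `c ^ 2 - c` counts the ordered pairs of distinct vertices of `B` that both complete
it. -/
theorem card_le_choose_add_sum {E : Finset (Finset α)} {V B : Finset α} {k : ℕ}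
    (hk : ∀ e ∈ E, #e = k) (hV : ∀ e ∈ E, e ⊆ V) (hB : ∀ e ∈ E, #(e ∩ B) = 1) :
    #E ≤ (#(V \ B)).choose (k - 1) + ∑ p ∈ B.offDiag,
      #{f ∈ (V \ B).powersetCard (k - 1) | insert p.1 f ∈ E ∧ insert p.2 f ∈ E} := by
  set P := (V \ B).powersetCard (k - 1) with hP
  have h1 : E ⊆ P.biUnion fun f => {b ∈ B | insert b f ∈ E}.image (insert · f) := by
    intro e he
    obtain ⟨b, hb⟩ := card_eq_one.1 (hB e he)
    have hbe : b ∈ e ∩ B := by rw [hb]; exact mem_singleton_self _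
    have heq : insert b (e \ B) = e := by
      rw [insert_eq, ← hb, inter_comm, union_comm, inter_comm, sdiff_union_inter]
    refine mem_biUnion.2 ⟨e \ B, mem_powersetCard.2 ⟨sdiff_subset_sdiff (hV e he) le_rfl, ?_⟩,
      mem_image.2 ⟨b, mem_filter.2 ⟨(mem_inter.1 hbe).2, heq.symm ▸ he⟩, heq⟩⟩
    have := card_sdiff_add_card_inter e B
    rw [hB e he, hk e he] at this
    omega
  have h2 : ∀ f ∈ P, #({b ∈ B | insert b f ∈ E}.image (insert · f)) ≤
      1 + #{p ∈ B.offDiag | insert p.1 f ∈ E ∧ insert p.2 f ∈ E} := by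
    intro f _
    have h3 : {p ∈ B.offDiag | insert p.1 f ∈ E ∧ insert p.2 f ∈ E} =
        ({b ∈ B | insert b f ∈ E} : Finset α).offDiag := by
      ext p
      simp only [mem_filter, mem_offDiag]
      tauto
    rw [h3, offDiag_card]
    refine card_image_le.trans ?_
    generalize #{b ∈ B | insert b f ∈ E} = c
    rcases c with _ | c
    · simp
    · rw [← Nat.mul_sub_one, Nat.add_sub_cancel]
      nlinarith
  calc #E ≤ _ := card_le_card h1
    _ ≤ ∑ f ∈ P, #({b ∈ B | insert b f ∈ E}.image (insert · f)) := card_biUnion_le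
    _ ≤ ∑ f ∈ P, (1 + #{p ∈ B.offDiag | insert p.1 f ∈ E ∧ insert p.2 f ∈ E}) := sum_le_sum h2
    _ = _ := by
      rw [sum_add_distrib, ← card_eq_sum_ones, hP, card_powersetCard]
      congr 1
      exact sum_card_bipartiteAbove_eq_sum_card_bipartiteBelow
        (fun f (p : α × α) => insert p.1 f ∈ E ∧ insert p.2 f ∈ E)

/-- Cauchy–Schwarz: some two vertices have a common link in `𝓛` whose density is at least half the
square of the density of `𝓛`. -/
theorem exists_pair_sq_card_le {𝓛 : Finset (Finset α)} {V : Finset α} {j : ℕ}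
    (h𝓛 : 𝓛 ⊆ V.powersetCard (j + 1)) (hne : 𝓛.Nonempty) (hcard : 2 * #V ^ j ≤ #𝓛) :
    ∃ x ∈ V, ∃ y ∈ V, x ≠ y ∧ #𝓛 ^ 2 ≤ 2 * #V ^ (j + 2) *
      #{g ∈ V.powersetCard j | (x ∉ g ∧ insert x g ∈ 𝓛) ∧ (y ∉ g ∧ insert y g ∈ 𝓛)} := by
  set n := #V with hn
  set Y := V.powersetCard j with hY
  set N : Finset α → Finset α := fun g => {x ∈ V | x ∉ g ∧ insert x g ∈ 𝓛} with hN
  have hn0 : 0 < n := by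
    obtain ⟨f, hf⟩ := hne
    have h1 := mem_powersetCard.1 (h𝓛 hf)
    have := card_le_card h1.1
    omega
  have hYn : #Y ≤ n ^ j := by rw [hY, card_powersetCard]; exact Nat.choose_le_pow _ _
  have hA : #𝓛 ≤ ∑ g ∈ Y, #(N g) := by
    have : 𝓛 ⊆ Y.biUnion fun g => (N g).image (insert · g) := by
      intro f hf
      obtain ⟨hfV, hfc⟩ := mem_powersetCard.1 (h𝓛 hf)
      obtain ⟨x, hx⟩ : f.Nonempty := card_pos.1 (by omega)
      refine mem_biUnion.2 ⟨f.erase x, mem_powersetCard.2 ⟨(erase_subset _ _).trans hfV, ?_⟩,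
        mem_image.2 ⟨x, mem_filter.2 ⟨hfV hx, notMem_erase _ _, ?_⟩, insert_erase hx⟩⟩
      · rw [card_erase_of_mem hx, hfc]; rfl
      · rwa [insert_erase hx]
    exact (card_le_card this).trans (card_biUnion_le.trans (sum_le_sum fun g _ => card_image_le))
  have hsq : (∑ g ∈ Y, #(N g)) ^ 2 ≤ n ^ j * ∑ g ∈ Y, #(N g) ^ 2 :=
    sq_sum_le_card_mul_sum_sq.trans (Nat.mul_le_mul_right _ hYn)
  have hsum : ∑ g ∈ Y, #(N g) ^ 2 = ∑ g ∈ Y, #(N g) + ∑ p ∈ V.offDiag, #{g ∈ Y |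
      (p.1 ∉ g ∧ insert p.1 g ∈ 𝓛) ∧ (p.2 ∉ g ∧ insert p.2 g ∈ 𝓛)} := by
    have hswap := sum_card_bipartiteAbove_eq_sum_card_bipartiteBelow (s := Y) (t := V.offDiag)
      (fun g (p : α × α) => (p.1 ∉ g ∧ insert p.1 g ∈ 𝓛) ∧ (p.2 ∉ g ∧ insert p.2 g ∈ 𝓛))
    unfold bipartiteBelow at hswap
    rw [← hswap, ← sum_add_distrib]
    refine sum_congr rfl fun g _ => ?_
    have : bipartiteAbove (fun g (p : α × α) =>
        (p.1 ∉ g ∧ insert p.1 g ∈ 𝓛) ∧ (p.2 ∉ g ∧ insert p.2 g ∈ 𝓛)) V.offDiag g =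
        (N g).offDiag := by
      ext p
      simp only [bipartiteAbove, hN, mem_filter, mem_offDiag]
      tauto
    rw [this, offDiag_card, sq]
    exact (Nat.add_sub_cancel' (Nat.le_mul_self _)).symm
  by_contra! hcon
  set A := ∑ g ∈ Y, #(N g) with hAdef
  set T := ∑ p ∈ V.offDiag, #{g ∈ Y |
      (p.1 ∉ g ∧ insert p.1 g ∈ 𝓛) ∧ (p.2 ∉ g ∧ insert p.2 g ∈ 𝓛)} with hT
  have hpos : 0 < #𝓛 := card_pos.2 hne
  have hupper : 2 * n ^ (j + 2) * T < n ^ 2 * #𝓛 ^ 2 := by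
    calc 2 * n ^ (j + 2) * T ≤ ∑ p ∈ V.offDiag, #𝓛 ^ 2 := by
          rw [hT, mul_sum]
          refine sum_le_sum fun p hp => ?_
          rw [mem_offDiag] at hp
          exact (hcon p.1 hp.1 p.2 hp.2.1 hp.2.2).le
      _ = (n * n - n) * #𝓛 ^ 2 := by rw [sum_const, offDiag_card, smul_eq_mul]
      _ < _ := by
        refine Nat.mul_lt_mul_of_pos_right ?_ (by positivity)
        rw [sq]
        exact Nat.sub_lt (by positivity) hn0
  have hlower : #𝓛 ^ 2 ≤ 2 * n ^ j * T := by
    have h1 : A ^ 2 ≤ n ^ j * A + n ^ j * T := by rw [← mul_add, ← hsum]; exact hsq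
    nlinarith
  have : n ^ 2 * #𝓛 ^ 2 ≤ 2 * n ^ (j + 2) * T := by
    calc n ^ 2 * #𝓛 ^ 2 ≤ n ^ 2 * (2 * n ^ j * T) := Nat.mul_le_mul_left _ hlower
      _ = _ := by ring
  omega

theorem exists_disjoint_of_lt_card {𝓛 : Finset (Finset α)} {V : Finset α} {j : ℕ}
    (h𝓛 : 𝓛 ⊆ V.powersetCard j) (hcard : j * #V ^ (j - 1) < #𝓛) :
    ∃ f ∈ 𝓛, ∃ g ∈ 𝓛, Disjoint f g := by
  obtain ⟨f, hf⟩ : 𝓛.Nonempty := card_pos.1 (by omega)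
  refine ⟨f, hf, ?_⟩
  by_contra! hcon
  have hsub : 𝓛 ⊆ f.biUnion fun x => {g ∈ 𝓛 | x ∈ g} := by
    intro g hg
    obtain ⟨x, hxf, hxg⟩ := not_disjoint_iff.1 (hcon g hg)
    exact mem_biUnion.2 ⟨x, hxf, mem_filter.2 ⟨hg, hxg⟩⟩
  have hdeg : ∀ x ∈ f, #{g ∈ 𝓛 | x ∈ g} ≤ #V ^ (j - 1) := by
    intro x _
    refine le_trans ?_ (Nat.choose_le_pow (#V) (j - 1))
    rw [← card_powersetCard]
    refine card_le_card_of_injOn (fun g => g.erase x) ?_ ?_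
    · intro g hg
      obtain ⟨hg, hx⟩ := mem_filter.1 (mem_coe.1 hg)
      obtain ⟨h1, h2⟩ := mem_powersetCard.1 (h𝓛 hg)
      exact mem_powersetCard.2 ⟨(erase_subset _ _).trans h1, by rw [card_erase_of_mem hx, h2]⟩
    · intro g hg g' hg' heq
      have h1 := (mem_filter.1 (mem_coe.1 hg)).2
      have h2 := (mem_filter.1 (mem_coe.1 hg')).2
      rw [← insert_erase h1, ← insert_erase h2]
      exact congrArg (insert x) heq
  have := (card_le_card hsub).trans (card_biUnion_le_card_mul _ _ _ hdeg)
  rw [(mem_powersetCard.1 (h𝓛 hf)).2] at this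
  omega

theorem insert_insert_sdiff_insert {S f : Finset α} {y z : α} (hy : y ∉ S) (hz : z ∉ f)
    (hyz : y ≠ z) : insert y (insert z S) \ insert y f = insert z (S \ f) := by
  grind

/-- A family of `(j + i)`-sets of density at least `2 * x` contains a subfamily of size
`2 ^ (i + 1)` that is closed under complementation in a set `S`, provided that `x ^ 2 ^ i` is not
below `j / #V`. Such a family in the common link of `y` and `z` yields one of twice the size by
adding `y` or `z` to each member. -/
theorem exists_complClosed (i : ℕ) : ∀ {𝓛 : Finset (Finset α)} {V : Finset α} {j : ℕ} {x : ℝ},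
    1 ≤ j → 𝓛 ⊆ V.powersetCard (j + i) → 0 < x → x ≤ 1 →
    2 * x * (#V : ℝ) ^ (j + i) ≤ #𝓛 → (j : ℝ) ≤ x ^ 2 ^ i * #V →
    ∃ S : Finset α, ∃ 𝓒 ⊆ 𝓛, #𝓒 = 2 ^ (i + 1) ∧ ∀ f ∈ 𝓒, f ⊆ S ∧ S \ f ∈ 𝓒 := by
  induction i with
  | zero =>
    intro 𝓛 V j x hj h𝓛 hx0 hx1 hcard hxn
    have hj' : (1 : ℝ) ≤ j := by exact_mod_cast hj
    simp only [pow_zero, pow_one, add_zero] at *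
    have hn : (0 : ℝ) < #V := by
      by_contra! h
      nlinarith
    have hlt : j * #V ^ (j - 1) < #𝓛 := by
      have h1 : (j : ℝ) * (#V : ℝ) ^ (j - 1) < #𝓛 := by
        have h2 : (#V : ℝ) ^ j = #V * (#V : ℝ) ^ (j - 1) := by
          rw [← pow_succ', Nat.sub_add_cancel hj]
        have h3 : (0 : ℝ) < (#V : ℝ) ^ (j - 1) := by positivity
        rw [h2] at hcard
        nlinarith [mul_le_mul_of_nonneg_right hxn h3.le]
      exact_mod_cast h1
    obtain ⟨f, hf, g, hg, hfg⟩ := exists_disjoint_of_lt_card h𝓛 hlt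
    have hne : f ≠ g := by
      rintro rfl
      have := (mem_powersetCard.1 (h𝓛 hf)).2
      rw [disjoint_self.1 hfg] at this
      simp at this
      omega
    refine ⟨f ∪ g, {f, g}, by simp [insert_subset_iff, hf, hg], by simp [hne], ?_⟩
    intro h hh
    rcases mem_insert.1 hh with rfl | hh
    · exact ⟨subset_union_left, by simp [union_sdiff_cancel_left hfg]⟩
    · rw [mem_singleton.1 hh]
      exact ⟨subset_union_right, by simp [union_sdiff_cancel_right hfg]⟩
  | succ i ih =>
    intro 𝓛 V j x hj h𝓛 hx0 hx1 hcard hxn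
    have hj' : (1 : ℝ) ≤ j := by exact_mod_cast hj
    have hn : (0 : ℝ) < #V := by
      by_contra! h
      have : (0 : ℝ) < x ^ 2 ^ (i + 1) := by positivity
      nlinarith
    have hxn1 : 1 ≤ x * #V := by
      have h1 : x ^ 2 ^ (i + 1) ≤ x := pow_le_of_le_one hx0.le hx1 (by positivity)
      nlinarith
    have h2 : 2 * (#V : ℝ) ^ (j + i) ≤ #𝓛 := by
      refine le_trans ?_ hcard
      rw [← add_assoc, pow_succ]
      have : (0 : ℝ) < (#V : ℝ) ^ (j + i) := by positivity
      nlinarith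
    have hpos : 𝓛.Nonempty := by
      have h3 : (0 : ℝ) < #𝓛 := lt_of_lt_of_le (by positivity) h2
      exact card_pos.1 (by exact_mod_cast h3)
    obtain ⟨y, hy, z, hz, hyz, hsq⟩ :=
      exists_pair_sq_card_le (j := j + i) h𝓛 hpos (by exact_mod_cast h2)
    set 𝓛' : Finset (Finset α) := {g ∈ V.powersetCard (j + i) |
      (y ∉ g ∧ insert y g ∈ 𝓛) ∧ (z ∉ g ∧ insert z g ∈ 𝓛)} with h𝓛'
    have hcard' : 2 * x ^ 2 * (#V : ℝ) ^ (j + i) ≤ #𝓛' := by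
      have h3 : (#𝓛 : ℝ) ^ 2 ≤ 2 * (#V : ℝ) ^ (j + i + 2) * #𝓛' := by exact_mod_cast hsq
      have h4 : (2 * x * (#V : ℝ) ^ (j + (i + 1))) ^ 2 ≤ (#𝓛 : ℝ) ^ 2 := by gcongr
      have h5 : (2 * x * (#V : ℝ) ^ (j + (i + 1))) ^ 2 =
          2 * (#V : ℝ) ^ (j + i + 2) * (2 * x ^ 2 * (#V : ℝ) ^ (j + i)) := by ring
      rw [h5] at h4
      exact le_of_mul_le_mul_left (h4.trans h3) (by positivity)
    obtain ⟨S, 𝓒, h𝓒, hc, hS⟩ := ih hj (filter_subset _ _) (by positivity)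
      (pow_le_one₀ hx0.le hx1) hcard' (by rw [← pow_mul, ← pow_succ']; exact hxn)
    have hmem : ∀ f ∈ 𝓒, (y ∉ f ∧ insert y f ∈ 𝓛) ∧ (z ∉ f ∧ insert z f ∈ 𝓛) :=
      fun f hf => (mem_filter.1 (h𝓒 hf)).2
    have h𝓒ne : 𝓒.Nonempty := card_pos.1 (by rw [hc]; positivity)
    obtain ⟨f₀, hf₀⟩ := h𝓒ne
    have hyS : y ∉ S := fun h => (hmem _ (hS f₀ hf₀).2).1.1 (mem_sdiff.2 ⟨h, (hmem f₀ hf₀).1.1⟩)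
    have hzS : z ∉ S := fun h => (hmem _ (hS f₀ hf₀).2).2.1 (mem_sdiff.2 ⟨h, (hmem f₀ hf₀).2.1⟩)
    have hinj : ∀ w, (∀ f ∈ 𝓒, w ∉ f) → Set.InjOn (insert w : Finset α → Finset α) 𝓒 := by
      intro w hw f hf g hg hfg
      rw [← erase_insert (hw f hf), ← erase_insert (hw g hg), hfg]
    have hdisj : Disjoint (𝓒.image (insert y)) (𝓒.image (insert z)) := by
      rw [disjoint_left]
      intro e he he'
      obtain ⟨f, hf, rfl⟩ := mem_image.1 he
      obtain ⟨g, hg, hfg⟩ := mem_image.1 he'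
      have : y ∈ insert z g := hfg ▸ mem_insert_self y f
      rcases mem_insert.1 this with h | h
      · exact hyz h
      · exact (hmem g hg).1.1 h
    refine ⟨insert y (insert z S), 𝓒.image (insert y) ∪ 𝓒.image (insert z), ?_, ?_, ?_⟩
    · refine union_subset ?_ ?_ <;> intro e he <;> obtain ⟨f, hf, rfl⟩ := mem_image.1 he
      · exact (hmem f hf).1.2
      · exact (hmem f hf).2.2
    · rw [card_union_of_disjoint hdisj, card_image_of_injOn (hinj y fun f hf => (hmem f hf).1.1),
        card_image_of_injOn (hinj z fun f hf => (hmem f hf).2.1), hc]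
      ring
    · intro e he
      rcases mem_union.1 he with he | he <;> obtain ⟨f, hf, rfl⟩ := mem_image.1 he
      · refine ⟨insert_subset_insert _ ((hS f hf).1.trans (subset_insert _ _)),
          mem_union_right _ (mem_image.2 ⟨S \ f, (hS f hf).2, ?_⟩)⟩
        exact (insert_insert_sdiff_insert hyS (hmem f hf).2.1 hyz).symm
      · refine ⟨insert_subset (by simp) ((hS f hf).1.trans
          ((subset_insert _ _).trans (subset_insert _ _))),
          mem_union_left _ (mem_image.2 ⟨S \ f, (hS f hf).2, ?_⟩)⟩
        rw [insert_comm]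
        exact (insert_insert_sdiff_insert hzS (hmem f hf).1.1 hyz.symm).symm

/-- For `r` members `f` of a family that is closed under complementation in `S`, the edges
`f ∪ {b}` and `(S \ f) ∪ {c}` form an `r`-regular family: a vertex of `S` lies in exactly one of
`f` and `S \ f`. -/
theorem hasRegularSubfamily_of_complClosed {E 𝓒 : Finset (Finset α)} {S : Finset α} {b c : α}
    {r : ℕ} (hr : 1 ≤ r) (hr𝓒 : r ≤ #𝓒) (hbc : b ≠ c) (hb : ∀ f ∈ 𝓒, b ∉ f ∧ insert b f ∈ E)
    (hc : ∀ f ∈ 𝓒, c ∉ f ∧ insert c f ∈ E) (hS : ∀ f ∈ 𝓒, f ⊆ S ∧ S \ f ∈ 𝓒) :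
    HasRegularSubfamily E r := by
  obtain ⟨A, hA, rfl⟩ := exists_subset_card_eq hr𝓒
  obtain ⟨f₀, hf₀⟩ : A.Nonempty := card_pos.1 hr
  have hout : ∀ w, (∀ f ∈ 𝓒, w ∉ f) → w ∉ S := fun w hw h =>
    hw _ (hS f₀ (hA hf₀)).2 (mem_sdiff.2 ⟨h, hw f₀ (hA hf₀)⟩)
  have hbS : b ∉ S := hout b fun f hf => (hb f hf).1
  have hcS : c ∉ S := hout c fun f hf => (hc f hf).1
  have hi₁ : Set.InjOn (insert b : Finset α → Finset α) A := by
    intro f hf g hg hfg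
    rw [← erase_insert (hb f (hA hf)).1, ← erase_insert (hb g (hA hg)).1, hfg]
  have hi₂ : Set.InjOn (fun f : Finset α => insert c (S \ f)) A := by
    intro f hf g hg hfg
    have h1 := (hS f (hA hf))
    have h2 := (hS g (hA hg))
    have h3 : S \ f = S \ g := by
      rw [← erase_insert (hc _ h1.2).1, ← erase_insert (hc _ h2.2).1]
      exact congrArg (fun s => s.erase c) hfg
    rw [← Finset.sdiff_sdiff_eq_self h1.1, h3, Finset.sdiff_sdiff_eq_self h2.1]
  have hdisj : Disjoint (A.image (insert b)) (A.image fun f => insert c (S \ f)) := by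
    rw [disjoint_left]
    intro e he he'
    obtain ⟨f, hf, rfl⟩ := mem_image.1 he
    obtain ⟨g, hg, hfg⟩ := mem_image.1 he'
    have : b ∈ insert c (S \ g) := by rw [hfg]; exact mem_insert_self _ _
    grind
  refine ⟨A.image (insert b) ∪ A.image (fun f => insert c (S \ f)), ?_,
    insert b (insert c S), insert_nonempty _ _, ?_, ?_⟩
  · refine union_subset ?_ ?_ <;> intro e he <;> obtain ⟨f, hf, rfl⟩ := mem_image.1 he
    · exact (hb f (hA hf)).2
    · exact (hc _ (hS f (hA hf)).2).2
  · intro x hx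
    rw [filter_union, card_union_of_disjoint (disjoint_filter_filter hdisj), filter_image,
      filter_image, card_image_of_injOn (hi₁.mono (by exact_mod_cast filter_subset _ _)),
      card_image_of_injOn (hi₂.mono (by exact_mod_cast filter_subset _ _))]
    have hAf : ∀ f ∈ A, f ⊆ S ∧ b ∉ f ∧ c ∉ f := fun f hf =>
      ⟨(hS f (hA hf)).1, (hb f (hA hf)).1, (hc f (hA hf)).1⟩
    rw [← card_filter_add_card_filter_not (s := A) (fun f => x ∈ insert b f)]
    congr 2
    refine filter_congr fun f hf => ?_
    have := hAf f hf
    grind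
  · intro e he
    rcases mem_union.1 he with he | he <;> obtain ⟨f, hf, rfl⟩ := mem_image.1 he
    · exact insert_subset_insert _ ((hS f (hA hf)).1.trans (subset_insert _ _))
    · exact (insert_subset_insert _ sdiff_subset).trans (subset_insert _ _)

end Boxes

/-! ### Peeling off the vertices of high degree -/

section Asymptotics

open Filter


theorem eventually_le_mul_rpow {a y : ℝ} (b : ℝ) (ha : 0 < a) (hy : 0 < y) :
    ∀ᶠ n : ℕ in atTop, b ≤ a * (n : ℝ) ^ y :=
  ((tendsto_rpow_atTop hy).comp tendsto_natCast_atTop_atTop).const_mul_atTop ha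
    |>.eventually_ge_atTop b

/-- Asymptotic form of `card_mul_pow_le`, applied with `m` of order `n ^ (γ' - ε)`. The factor
`m ^ (k - 2) ≥ m ^ 2` contributes `2 * (γ' - ε)` to the exponent, which has to exceed `γ + ε`. -/
theorem eventually_card_le_of_hitting {k r : ℕ} (hk : 4 ≤ k) (hr : 1 ≤ r) {ε γ γ' c C : ℝ}
    (hc : 0 < c) (hεγ' : ε < γ') (hγ : γ + 3 * ε < 2 * γ') :
    ∀ᶠ n : ℕ in atTop, ∀ (α : Type u) [DecidableEq α] (E : Finset (Finset α)) (V B : Finset α),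
      #V = n → (∀ e ∈ E, #e = k) → (∀ e ∈ E, e ⊆ V) → (∀ e ∈ E, (e ∩ B).Nonempty) →
      (#B : ℝ) ≤ C * (n : ℝ) ^ γ →
      (∀ x, (#{e ∈ E | x ∈ e} : ℝ) ≤ (n : ℝ) ^ ((k : ℝ) - 1 - γ')) →
      ¬ HasRegularSubfamily E r → (#E : ℝ) ≤ c * (n : ℝ) ^ ((k : ℝ) - 1 - ε) := by
  have hk0 : (0 : ℝ) < k := by positivity
  filter_upwards [eventually_le_mul_rpow 2 (div_pos hc (mul_pos two_pos hk0)) (sub_pos.2 hεγ'),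
    eventually_le_mul_rpow (2 * r * C) (a := c * (c / (4 * k)) ^ 2) (by positivity)
      (sub_pos.2 hγ), eventually_gt_atTop 0] with n h1 h2 hn α _ E V B hVn hEk hEV hEB hB hΔ hreg
  by_contra! hE
  have hN : (0 : ℝ) < n := by exact_mod_cast hn
  obtain ⟨v, -⟩ : V.Nonempty := card_pos.1 (by omega)
  have : Nonempty α := ⟨v⟩
  set μ : ℝ := c / (2 * k) * (n : ℝ) ^ (γ' - ε) with hμ
  have hm : μ / 2 ≤ (⌊μ⌋₊ : ℝ) := by
    have := Nat.lt_floor_add_one μ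
    linarith
  have hm' : (⌊μ⌋₊ : ℝ) ≤ μ := Nat.floor_le (by linarith)
  set m := ⌊μ⌋₊ with hmdef
  have hm1 : (1 : ℝ) ≤ m := by linarith
  set Δ := ⌊(n : ℝ) ^ ((k : ℝ) - 1 - γ')⌋₊ with hΔdef
  have hΔ' : (Δ : ℝ) ≤ (n : ℝ) ^ ((k : ℝ) - 1 - γ') := Nat.floor_le (by positivity)
  have hmul : (n : ℝ) ^ (γ' - ε) * (n : ℝ) ^ ((k : ℝ) - 1 - γ') = (n : ℝ) ^ ((k : ℝ) - 1 - ε) := by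
    rw [← Real.rpow_add hN]
    congr 1
    ring
  have hbig : 2 * (m * k * Δ) ≤ #E := by
    have : (2 * (m * k * Δ) : ℝ) ≤ #E := by
      calc (2 * (m * k * Δ) : ℝ) ≤ 2 * (μ * k * (n : ℝ) ^ ((k : ℝ) - 1 - γ')) := by gcongr
        _ = c * ((n : ℝ) ^ (γ' - ε) * (n : ℝ) ^ ((k : ℝ) - 1 - γ')) := by
          rw [hμ]; field_simp
        _ ≤ #E := by rw [hmul]; exact hE.le
    exact_mod_cast this
  have key := card_mul_pow_le (Δ := Δ) (m := m) hr hEk (by omega) hEV hEB hreg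
    (fun x => Nat.le_floor (hΔ x)) (by rintro h; rw [h] at hm1; norm_num at hm1) hbig
  rw [hVn] at key
  have key' : (#E : ℝ) * (m : ℝ) ^ (k - 2) ≤ 2 * r * (C * (n : ℝ) ^ γ) * (n : ℝ) ^ (k - 1) := by
    calc (#E : ℝ) * (m : ℝ) ^ (k - 2) ≤ 2 * ((r - 1 : ℕ) : ℝ) * #B * (n : ℝ) ^ (k - 1) := by
          exact_mod_cast key
      _ ≤ _ := by
        have : ((r - 1 : ℕ) : ℝ) ≤ r := by exact_mod_cast Nat.sub_le r 1
        gcongr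
  have hm2 : (μ / 2) ^ 2 ≤ (m : ℝ) ^ (k - 2) :=
    calc (μ / 2) ^ 2 ≤ (m : ℝ) ^ 2 := by gcongr
      _ ≤ (m : ℝ) ^ (k - 2) := pow_le_pow_right₀ hm1 (by omega)
  have hlow : c * (n : ℝ) ^ ((k : ℝ) - 1 - ε) * (μ / 2) ^ 2 < #E * (m : ℝ) ^ (k - 2) := by
    have : 0 < (μ / 2) ^ 2 := by
      have : 0 < μ := by linarith
      positivity
    exact mul_lt_mul hE hm2 this (by positivity)
  have hpow : c * (n : ℝ) ^ ((k : ℝ) - 1 - ε) * (μ / 2) ^ 2 =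
      (c * (c / (4 * k)) ^ 2 * (n : ℝ) ^ (2 * γ' - (γ + 3 * ε))) *
        ((n : ℝ) ^ γ * (n : ℝ) ^ (k - 1)) := by
    have e1 : (n : ℝ) ^ (k - 1) = (n : ℝ) ^ ((k : ℝ) - 1) := by
      rw [← Real.rpow_natCast, Nat.cast_sub (by omega), Nat.cast_one]
    have e2 : (n : ℝ) ^ ((k : ℝ) - 1 - ε) * ((n : ℝ) ^ (γ' - ε)) ^ 2 =
        (n : ℝ) ^ (2 * γ' - (γ + 3 * ε)) * ((n : ℝ) ^ γ * (n : ℝ) ^ ((k : ℝ) - 1)) := by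
      rw [← Real.rpow_mul_natCast hN.le, ← Real.rpow_add hN, ← Real.rpow_add hN,
        ← Real.rpow_add hN]
      congr 1
      push_cast
      ring
    have e3 : (μ / 2) ^ 2 = (c / (4 * k)) ^ 2 * ((n : ℝ) ^ (γ' - ε)) ^ 2 := by
      rw [hμ]; ring
    rw [e1, e3]
    linear_combination c * (c / (4 * k)) ^ 2 * e2
  have hfin : 2 * r * C * ((n : ℝ) ^ γ * (n : ℝ) ^ (k - 1)) ≤
      (c * (c / (4 * k)) ^ 2 * (n : ℝ) ^ (2 * γ' - (γ + 3 * ε))) *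
        ((n : ℝ) ^ γ * (n : ℝ) ^ (k - 1)) := by gcongr
  rw [hpow] at hlow
  linarith

variable {α : Type u} [DecidableEq α]

/-- The vertices in `V` that lie in more than `t` members of `E`. -/
noncomputable def highDegree (E : Finset (Finset α)) (V : Finset α) (t : ℝ) : Finset α :=
  {x ∈ V | t < #{e ∈ E | x ∈ e}}

theorem card_highDegree_mul_le {E : Finset (Finset α)} {k : ℕ} (hEk : ∀ e ∈ E, #e = k)
    (V : Finset α) (t : ℝ) : #(highDegree E V t) * t ≤ k * #E := by
  calc #(highDegree E V t) * t = ∑ x ∈ highDegree E V t, t := by rw [sum_const, nsmul_eq_mul]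
    _ ≤ ∑ x ∈ highDegree E V t, (#{e ∈ E | x ∈ e} : ℝ) :=
      sum_le_sum fun x hx => (mem_filter.1 hx).2.le
    _ = ((∑ e ∈ E, #{x ∈ highDegree E V t | x ∈ e} : ℕ) : ℝ) := by
      have := sum_card_bipartiteAbove_eq_sum_card_bipartiteBelow
        (s := highDegree E V t) (t := E) (fun x e => x ∈ e)
      unfold bipartiteAbove bipartiteBelow at this
      exact_mod_cast this
    _ ≤ ((∑ e ∈ E, k : ℕ) : ℝ) := by
      refine Nat.cast_le.2 (sum_le_sum fun e he => ?_)
      rw [← hEk e he]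
      exact card_le_card fun x hx => (mem_filter.1 hx).2
    _ = _ := by simp [mul_comm]

theorem card_filter_mem_le_of_disjoint_highDegree {E : Finset (Finset α)} {V : Finset α} {t : ℝ}
    (hEV : ∀ e ∈ E, e ⊆ V) (ht : 0 ≤ t) {E' : Finset (Finset α)} (hE' : E' ⊆ E)
    (hdis : ∀ e ∈ E', Disjoint e (highDegree E V t)) (x : α) :
    (#{e ∈ E' | x ∈ e} : ℝ) ≤ t := by
  by_cases h : {e ∈ E' | x ∈ e}.Nonempty
  · obtain ⟨e, he⟩ := h
    obtain ⟨he, hx⟩ := mem_filter.1 he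
    have hxV := hEV e (hE' he) hx
    have hnot : x ∉ highDegree E V t := disjoint_left.1 (hdis e he) hx
    have hle : (#{e ∈ E | x ∈ e} : ℝ) ≤ t := by
      by_contra! hlt
      exact hnot (mem_filter.2 ⟨hxV, hlt⟩)
    refine le_trans ?_ hle
    exact_mod_cast card_le_card (filter_subset_filter _ hE')
  · rw [not_nonempty_iff_eq_empty.1 h]
    simpa using ht

/-- The degree thresholds `n ^ (k - 1 - γ i)` with `γ i = 16 / 5 * ε + 2 ^ (-i)` satisfy
`2 * γ (i + 1) = γ i + 16 / 5 * ε`, just more than `γ i + 3 * ε`, so that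
`eventually_card_le_of_hitting` bounds the edges gained from each threshold to the next. -/
theorem eventually_card_disjoint_highDegree_le {k r : ℕ} (hk : 4 ≤ k) (hr : 1 ≤ r) {ε C : ℝ}
    (hε : 0 < ε) (i : ℕ) : ∀ c : ℝ, 0 < c →
    ∀ᶠ n : ℕ in atTop, ∀ (α : Type u) [DecidableEq α] (E : Finset (Finset α)) (V : Finset α),
      #V = n → (∀ e ∈ E, #e = k) → (∀ e ∈ E, e ⊆ V) → (#E : ℝ) ≤ C * (n : ℝ) ^ ((k : ℝ) - 1) →
      ¬ HasRegularSubfamily E r →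
      (#{e ∈ E | Disjoint e
          (highDegree E V ((n : ℝ) ^ ((k : ℝ) - 1 - (16 / 5 * ε + (1 / 2) ^ (i + 1)))))} : ℝ) ≤
        c * (n : ℝ) ^ ((k : ℝ) - 1 - ε) := by
  induction i with
  | zero =>
    intro c hc
    filter_upwards [eventually_card_le_of_hitting (ε := ε) (γ := 1)
      (γ' := 16 / 5 * ε + (1 / 2) ^ (0 + 1)) (C := 1) hk hr hc (by norm_num; linarith)
      (by norm_num; linarith)] with n h α _ E V hVn hEk hEV hE hreg
    refine h α _ V V hVn (fun e he => hEk e (filter_subset _ _ he))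
      (fun e he => hEV e (filter_subset _ _ he)) (fun e he => ?_) (by simp [hVn]) ?_
      fun hreg' => hreg (hreg'.mono (filter_subset _ _))
    · have he' := filter_subset _ _ he
      rw [inter_eq_left.2 (hEV e he')]
      exact card_pos.1 (by rw [hEk e he']; omega)
    · exact card_filter_mem_le_of_disjoint_highDegree hEV (by positivity) (filter_subset _ _)
        fun e he => (mem_filter.1 he).2
  | succ i ih =>
    intro c hc
    set γ : ℝ := 16 / 5 * ε + (1 / 2) ^ (i + 1) with hγ
    set γ' : ℝ := 16 / 5 * ε + (1 / 2) ^ (i + 1 + 1) with hγ'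
    have hp : (0 : ℝ) < (1 / 2) ^ (i + 1) := by positivity
    have hhalf : ((1 : ℝ) / 2) ^ (i + 1 + 1) = (1 / 2) ^ (i + 1) / 2 := by
      rw [pow_succ _ (i + 1)]; ring
    filter_upwards [ih (c / 2) (by positivity), eventually_card_le_of_hitting (ε := ε) (γ := γ)
      (γ' := γ') (C := k * C) hk hr (half_pos hc) (by linarith [hhalf]) (by linarith [hhalf]), eventually_gt_atTop 0]
      with n h1 h2 hn α _ E V hVn hEk hEV hE hreg
    have hN : (0 : ℝ) < n := by exact_mod_cast hn
    set B := highDegree E V ((n : ℝ) ^ ((k : ℝ) - 1 - γ)) with hB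
    set B' := highDegree E V ((n : ℝ) ^ ((k : ℝ) - 1 - γ')) with hB'
    have hBcard : (#B : ℝ) ≤ k * C * (n : ℝ) ^ γ := by
      have h3 := card_highDegree_mul_le hEk V ((n : ℝ) ^ ((k : ℝ) - 1 - γ))
      have h4 : (0 : ℝ) < (n : ℝ) ^ ((k : ℝ) - 1 - γ) := by positivity
      have h5 : (n : ℝ) ^ ((k : ℝ) - 1) = (n : ℝ) ^ γ * (n : ℝ) ^ ((k : ℝ) - 1 - γ) := by
        rw [← Real.rpow_add hN]; congr 1; ring
      refine le_of_mul_le_mul_right (h3.trans ?_) h4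
      calc (k : ℝ) * #E ≤ k * (C * (n : ℝ) ^ ((k : ℝ) - 1)) := by gcongr
        _ = _ := by rw [h5]; ring
    have h3 := h1 α E V hVn hEk hEV hE hreg
    have h4 := h2 α {e ∈ E | Disjoint e B' ∧ ¬ Disjoint e B} V B hVn
      (fun e he => hEk e (filter_subset _ _ he)) (fun e he => hEV e (filter_subset _ _ he))
      (fun e he => not_disjoint_iff_nonempty_inter.1 (mem_filter.1 he).2.2) hBcard
      (card_filter_mem_le_of_disjoint_highDegree hEV (by positivity) (filter_subset _ _)
        fun e he => (mem_filter.1 he).2.1)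
      fun hreg' => hreg (hreg'.mono (filter_subset _ _))
    have h5 : {e ∈ E | Disjoint e B'} ⊆
        {e ∈ E | Disjoint e B} ∪ {e ∈ E | Disjoint e B' ∧ ¬ Disjoint e B} := by
      intro e he
      simp only [mem_union, mem_filter] at he ⊢
      tauto
    have h6 : (#{e ∈ E | Disjoint e B'} : ℝ) ≤
        #{e ∈ E | Disjoint e B} + #{e ∈ E | Disjoint e B' ∧ ¬ Disjoint e B} := by
      exact_mod_cast (card_le_card h5).trans (card_union_le _ _)
    linarith

theorem card_filter_two_le_card_inter_le {E : Finset (Finset α)} {V : Finset α} {k : ℕ}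
    (hEk : ∀ e ∈ E, #e = k) (hEV : ∀ e ∈ E, e ⊆ V) (B : Finset α) :
    #{e ∈ E | 2 ≤ #(e ∩ B)} ≤ #B ^ 2 * #V ^ (k - 2) := by
  have hsub : {e ∈ E | 2 ≤ #(e ∩ B)} ⊆
      ((B ×ˢ B) ×ˢ V.powersetCard (k - 2)).image fun q => insert q.1.1 (insert q.1.2 q.2) := by
    intro e he
    obtain ⟨he, h2⟩ := mem_filter.1 he
    obtain ⟨b, hb, c, hc, hbc⟩ := one_lt_card.1 h2
    rw [mem_inter] at hb hc
    have hcb : c ∈ e.erase b := mem_erase.2 ⟨hbc.symm, hc.1⟩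
    refine mem_image.2 ⟨((b, c), (e.erase b).erase c), mem_product.2 ⟨mem_product.2 ⟨hb.2, hc.2⟩,
      mem_powersetCard.2 ⟨(erase_subset _ _).trans ((erase_subset _ _).trans (hEV e he)), ?_⟩⟩, ?_⟩
    · rw [card_erase_of_mem hcb, card_erase_of_mem hb.1, hEk e he]
      rfl
    · simp only [insert_erase hcb, insert_erase hb.1]
  refine (card_le_card hsub).trans (card_image_le.trans ?_)
  rw [card_product, card_product, card_powersetCard, ← sq]
  exact Nat.mul_le_mul_left _ (Nat.choose_le_pow _ _)

end Asymptotics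

/-! ### The extremal bound -/

section Extremal

open Filter

/-- The number of Cauchy–Schwarz steps is `s = ⌊log₂ (r - 1)⌋`, so that
`2 ^ s ≤ r - 1 < 2 ^ (s + 1)`. -/
theorem hasRegularSubfamily_of_common_links {α : Type*} [DecidableEq α]
    {E 𝓛 : Finset (Finset α)} {V : Finset α} {b c : α} {k r : ℕ} {x : ℝ} (hr : 2 ≤ r) (hrk : r < k)
    (hbc : b ≠ c) (h𝓛 : 𝓛 ⊆ V.powersetCard (k - 1)) (hb : ∀ f ∈ 𝓛, b ∉ f ∧ insert b f ∈ E)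
    (hc : ∀ f ∈ 𝓛, c ∉ f ∧ insert c f ∈ E) (hx0 : 0 < x) (hx1 : x ≤ 1)
    (hcard : 2 * x * (#V : ℝ) ^ (k - 1) ≤ #𝓛) (hx : (k : ℝ) ≤ x ^ (r - 1) * #V) :
    HasRegularSubfamily E r := by
  set s := Nat.log 2 (r - 1) with hs
  have h1 : 2 ^ s ≤ r - 1 := Nat.pow_log_le_self 2 (by omega)
  have h2 : r - 1 < 2 ^ (s + 1) := Nat.lt_pow_succ_log_self one_lt_two _
  have h3 : s < 2 ^ s := Nat.lt_two_pow_self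
  obtain ⟨j, hj⟩ : ∃ j, k - 1 = j + s := ⟨k - 1 - s, by omega⟩
  rw [hj] at h𝓛 hcard
  have hjk : (j : ℝ) ≤ x ^ 2 ^ s * #V := by
    calc (j : ℝ) ≤ k := by exact_mod_cast (by omega)
      _ ≤ x ^ (r - 1) * #V := hx
      _ ≤ _ := by gcongr ?_ * _; exact pow_le_pow_of_le_one hx0.le hx1 h1
  obtain ⟨S, 𝓒, h𝓒, hcard𝓒, hS⟩ := exists_complClosed s (by omega) h𝓛 hx0 hx1 hcard hjk
  exact hasRegularSubfamily_of_complClosed (by omega) (by rw [hcard𝓒]; omega) hbc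
    (fun f hf => hb f (h𝓒 hf)) (fun f hf => hc f (h𝓒 hf)) hS

theorem exists_mem_offDiag_le_card_common_links {α : Type*} [DecidableEq α]
    {E : Finset (Finset α)} {V B : Finset α} {k : ℕ} {t : ℝ} (hEk : ∀ e ∈ E, #e = k)
    (hEV : ∀ e ∈ E, e ⊆ V) (hEB : ∀ e ∈ E, #(e ∩ B) = 1) (hBV : B ⊆ V) (ht : 0 ≤ t)
    (hE : ((#V - 1).choose (k - 1) : ℝ) + t < #E) :
    ∃ p ∈ B.offDiag, t ≤ (#B : ℝ) ^ 2 *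
      #{f ∈ (V \ B).powersetCard (k - 1) | insert p.1 f ∈ E ∧ insert p.2 f ∈ E} := by
  have hEne : E.Nonempty := by
    have : (0 : ℝ) < #E := lt_of_le_of_lt (by positivity) hE
    exact card_pos.1 (by exact_mod_cast this)
  have hBne : 0 < #B := by
    obtain ⟨e, he⟩ := hEne
    obtain ⟨b, hb⟩ : (e ∩ B).Nonempty := card_pos.1 (by rw [hEB e he]; exact one_pos)
    exact card_pos.2 ⟨b, (mem_inter.1 hb).2⟩
  have h1 := card_le_choose_add_sum hEk hEV hEB
  have h2 : (#(V \ B)).choose (k - 1) ≤ (#V - 1).choose (k - 1) := by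
    refine Nat.choose_le_choose _ ?_
    rw [card_sdiff_of_subset hBV]
    omega
  have h3 : t < ∑ p ∈ B.offDiag,
      (#{f ∈ (V \ B).powersetCard (k - 1) | insert p.1 f ∈ E ∧ insert p.2 f ∈ E} : ℝ) := by
    have h4 : (#E : ℝ) ≤ ((#V - 1).choose (k - 1) : ℝ) + ∑ p ∈ B.offDiag,
        (#{f ∈ (V \ B).powersetCard (k - 1) | insert p.1 f ∈ E ∧ insert p.2 f ∈ E} : ℝ) := by
      exact_mod_cast h1.trans (Nat.add_le_add_right h2 _)
    linarith
  by_contra! hcon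
  have hB2 : (0 : ℝ) < (#B : ℝ) ^ 2 := by positivity
  have h5 : ∑ p ∈ B.offDiag,
      (#{f ∈ (V \ B).powersetCard (k - 1) | insert p.1 f ∈ E ∧ insert p.2 f ∈ E} : ℝ) ≤ t := by
    calc _ ≤ ∑ p ∈ B.offDiag, t / (#B : ℝ) ^ 2 := sum_le_sum fun p hp => by
          rw [le_div_iff₀ hB2, mul_comm]
          exact (hcon p hp).le
      _ = (#B.offDiag : ℝ) * (t / (#B : ℝ) ^ 2) := by rw [sum_const, nsmul_eq_mul]
      _ ≤ (#B : ℝ) ^ 2 * (t / (#B : ℝ) ^ 2) := by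
        gcongr
        rw [offDiag_card, sq]
        exact_mod_cast Nat.sub_le _ _
      _ = t := by field_simp
  linarith

/-- The bound with exponent `k - 1 - 1 / (2 * r ^ 2 - 2)`, for all `k > r ≥ 3`. -/
theorem eventually_card_le_choose_add {k r : ℕ} (hr : 3 ≤ r) (hrk : r < k) :
    ∀ᶠ n : ℕ in atTop, ∀ (α : Type u) [DecidableEq α] (E : Finset (Finset α)) (V : Finset α),
      #V = n → (∀ e ∈ E, #e = k) → (∀ e ∈ E, e ⊆ V) → ¬ HasRegularSubfamily E r →
      (#E : ℝ) ≤ ((n - 1).choose (k - 1) : ℝ) +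
        3 * (n : ℝ) ^ ((k : ℝ) - 1 - 1 / (2 * (r : ℝ) ^ 2 - 2)) := by
  have hr3 : (3 : ℝ) ≤ r := by exact_mod_cast hr
  have hk4 : (4 : ℝ) ≤ k := by exact_mod_cast (show 4 ≤ k by omega)
  have hD : (0 : ℝ) < 2 * (r : ℝ) ^ 2 - 2 := by nlinarith
  set ε : ℝ := 1 / (2 * (r : ℝ) ^ 2 - 2) with hε
  have hε0 : 0 < ε := by positivity
  have hεr : ε * (2 * (r : ℝ) ^ 2 - 2) = 1 := one_div_mul_cancel hD.ne'
  have hε16 : ε ≤ 1 / 16 := by nlinarith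
  obtain ⟨i, hi⟩ := exists_pow_lt_of_lt_one (show (0 : ℝ) < ε / 5 by positivity)
    (show (1 / 2 : ℝ) < 1 by norm_num)
  have hi' : ((1 : ℝ) / 2) ^ (i + 1) ≤ ε / 5 :=
    (pow_le_pow_of_le_one (by norm_num) (by norm_num) (Nat.le_succ i)).trans hi.le
  set γ : ℝ := 16 / 5 * ε + (1 / 2) ^ (i + 1) with hγ
  have hγε : γ ≤ 17 / 5 * ε := by linarith
  have hγ0 : 0 < γ := by positivity
  -- This is where the value of `ε` enters: `ε + 2 * γ ≤ 39 / 5 * ε`, and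
  -- `8 * ε * (r - 1) = 4 / (r + 1) ≤ 1`.
  have hexp : 0 < 1 - (ε + 2 * γ) * ((r - 1 : ℕ) : ℝ) := by
    rw [Nat.cast_sub (by omega), Nat.cast_one]
    have h1 : (ε + 2 * γ) * ((r : ℝ) - 1) ≤ 39 / 5 * ε * ((r : ℝ) - 1) := by
      have : (0 : ℝ) ≤ (r : ℝ) - 1 := by linarith
      gcongr
      linarith
    have h2 : 8 * (ε * ((r : ℝ) - 1)) ≤ 1 := by
      have : 0 < ε * ((r : ℝ) - 1) := mul_pos hε0 (by linarith)
      nlinarith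
    have : 0 < ε * ((r : ℝ) - 1) := mul_pos hε0 (by linarith)
    linarith
  set a : ℝ := 1 / (50 * (k : ℝ) ^ 2) with ha
  have ha0 : 0 < a := by positivity
  have ha1 : a ≤ 1 := by
    rw [ha, div_le_one (by positivity)]
    nlinarith
  filter_upwards [eventually_card_disjoint_highDegree_le (k := k) (r := r) (ε := ε) (C := 5)
      (by omega) (by omega) hε0 i 1 one_pos,
    eventually_le_mul_rpow ((5 * (k : ℝ)) ^ 2) one_pos (show 0 < 1 - (ε + 2 * γ) by linarith),
    eventually_le_mul_rpow (k : ℝ) (pow_pos ha0 (r - 1)) hexp,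
    eventually_ge_atTop 1] with n h1 h2 h3 hn α _ E V hVn hEk hEV hreg
  have hN1 : (1 : ℝ) ≤ n := by exact_mod_cast hn
  have hN : (0 : ℝ) < n := by linarith
  by_contra! hE
  set t : ℝ := (n : ℝ) ^ ((k : ℝ) - 1 - ε) with ht
  have ht0 : 0 < t := by positivity
  have hNk : (n : ℝ) ^ (k - 1) = (n : ℝ) ^ ((k : ℝ) - 1) := by
    rw [← Real.rpow_natCast, Nat.cast_sub (by omega), Nat.cast_one]
  -- Pass to a subfamily that only just exceeds the bound, so that it has `O(n ^ (k - 1))` members.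
  set b : ℝ := ((n - 1).choose (k - 1) : ℝ) + 3 * t with hb
  have hb0 : 0 ≤ b := by positivity
  obtain ⟨E', hE', hcardE'⟩ : ∃ E' ⊆ E, #E' = ⌊b⌋₊ + 1 :=
    exists_subset_card_eq ((Nat.floor_lt hb0).2 hE)
  have hlo : b < #E' := by rw [hcardE']; exact_mod_cast Nat.lt_floor_add_one b
  have hup : (#E' : ℝ) ≤ 5 * (n : ℝ) ^ ((k : ℝ) - 1) := by
    have e1 : (#E' : ℝ) ≤ b + 1 := by
      rw [hcardE']
      push_cast
      linarith [Nat.floor_le hb0]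
    have e2 : ((n - 1).choose (k - 1) : ℝ) ≤ (n : ℝ) ^ ((k : ℝ) - 1) := by
      rw [← hNk]
      exact_mod_cast (Nat.choose_le_pow _ _).trans (Nat.pow_le_pow_left (Nat.sub_le n 1) _)
    have e3 : t ≤ (n : ℝ) ^ ((k : ℝ) - 1) := Real.rpow_le_rpow_of_exponent_le hN1 (by linarith)
    have e4 : (1 : ℝ) ≤ (n : ℝ) ^ ((k : ℝ) - 1) := Real.one_le_rpow hN1 (by linarith)
    linarith
  have hEk' : ∀ e ∈ E', #e = k := fun e he => hEk e (hE' he)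
  have hEV' : ∀ e ∈ E', e ⊆ V := fun e he => hEV e (hE' he)
  have hreg' : ¬ HasRegularSubfamily E' r := fun h => hreg (h.mono hE')
  set B := highDegree E' V ((n : ℝ) ^ ((k : ℝ) - 1 - γ)) with hB
  have hBV : B ⊆ V := filter_subset _ _
  have hBcard : (#B : ℝ) ≤ 5 * k * (n : ℝ) ^ γ := by
    have e1 := card_highDegree_mul_le hEk' V ((n : ℝ) ^ ((k : ℝ) - 1 - γ))
    have e2 : (0 : ℝ) < (n : ℝ) ^ ((k : ℝ) - 1 - γ) := by positivity
    have e3 : (n : ℝ) ^ ((k : ℝ) - 1) = (n : ℝ) ^ γ * (n : ℝ) ^ ((k : ℝ) - 1 - γ) := by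
      rw [← Real.rpow_add hN]; congr 1; ring
    refine le_of_mul_le_mul_right (e1.trans ?_) e2
    calc (k : ℝ) * #E' ≤ k * (5 * (n : ℝ) ^ ((k : ℝ) - 1)) := by gcongr
      _ = _ := by rw [e3]; ring
  have hBsq : (#B : ℝ) ^ 2 ≤ (5 * k) ^ 2 * (n : ℝ) ^ (2 * γ) := by
    calc (#B : ℝ) ^ 2 ≤ (5 * k * (n : ℝ) ^ γ) ^ 2 := by gcongr
      _ = _ := by
        rw [mul_pow, ← Real.rpow_mul_natCast hN.le]
        congr 2
        push_cast
        ring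
  have hzero : (#{e ∈ E' | Disjoint e B} : ℝ) ≤ t := by
    have := h1 α E' V hVn hEk' hEV' hup hreg'
    rwa [one_mul] at this
  -- The edges meeting `B` twice number `O(n ^ (k - 2 + 2 * γ))`.
  have htwo : (#{e ∈ E' | 2 ≤ #(e ∩ B)} : ℝ) ≤ t := by
    have e1 : (#{e ∈ E' | 2 ≤ #(e ∩ B)} : ℝ) ≤ (#B : ℝ) ^ 2 * (n : ℝ) ^ (k - 2) := by
      have := card_filter_two_le_card_inter_le hEk' hEV' B
      rw [hVn] at this
      exact_mod_cast this
    have e2 : (n : ℝ) ^ (k - 2) = (n : ℝ) ^ ((k : ℝ) - 2) := by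
      rw [← Real.rpow_natCast, Nat.cast_sub (by omega), Nat.cast_ofNat]
    calc (#{e ∈ E' | 2 ≤ #(e ∩ B)} : ℝ) ≤ (#B : ℝ) ^ 2 * (n : ℝ) ^ ((k : ℝ) - 2) := e2 ▸ e1
      _ ≤ ((1 * (n : ℝ) ^ (1 - (ε + 2 * γ))) * (n : ℝ) ^ (2 * γ)) * (n : ℝ) ^ ((k : ℝ) - 2) := by
        gcongr
        exact hBsq.trans (by gcongr)
      _ = t := by
        rw [one_mul, ← Real.rpow_add hN, ← Real.rpow_add hN, ht]
        congr 1
        ring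
  set E₁ : Finset (Finset α) := {e ∈ E' | #(e ∩ B) = 1} with hE₁
  have hone : ((#V - 1).choose (k - 1) : ℝ) + t < #E₁ := by
    have e1 : E' ⊆ ({e ∈ E' | Disjoint e B} ∪ {e ∈ E' | 2 ≤ #(e ∩ B)}) ∪ E₁ := by
      intro e he
      simp only [hE₁, mem_union, mem_filter, he, true_and, disjoint_iff_inter_eq_empty,
        ← card_eq_zero]
      omega
    have e2 : (#E' : ℝ) ≤ #{e ∈ E' | Disjoint e B} + #{e ∈ E' | 2 ≤ #(e ∩ B)} + #E₁ := by
      exact_mod_cast (card_le_card e1).trans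
        ((card_union_le _ _).trans (Nat.add_le_add_right (card_union_le _ _) _))
    rw [hVn]
    linarith
  obtain ⟨p, hp, hpt⟩ := exists_mem_offDiag_le_card_common_links
    (fun e he => hEk' e (filter_subset _ _ he)) (fun e he => hEV' e (filter_subset _ _ he))
    (fun e he => (mem_filter.1 he).2) hBV ht0.le hone
  rw [mem_offDiag] at hp
  set 𝓛 : Finset (Finset α) :=
    {f ∈ (V \ B).powersetCard (k - 1) | insert p.1 f ∈ E₁ ∧ insert p.2 f ∈ E₁} with h𝓛
  have hlink : ∀ f ∈ 𝓛, ∀ w ∈ B, w ∉ f := fun f hf w hw hwf =>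
    (mem_sdiff.1 ((mem_powersetCard.1 (mem_filter.1 hf).1).1 hwf)).2 hw
  refine hreg' (HasRegularSubfamily.mono (filter_subset _ _)
    (hasRegularSubfamily_of_common_links (E := E₁) (𝓛 := 𝓛) (V := V)
      (x := a * (n : ℝ) ^ (-(ε + 2 * γ))) (by omega) hrk hp.2.2 ?_
      (fun f hf => ⟨hlink f hf _ hp.1, (mem_filter.1 hf).2.1⟩)
      (fun f hf => ⟨hlink f hf _ hp.2.1, (mem_filter.1 hf).2.2⟩) (by positivity) ?_ ?_ ?_))
  · exact (filter_subset _ _).trans (powersetCard_mono sdiff_subset)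
  · exact mul_le_one₀ ha1 (by positivity) (Real.rpow_le_one_of_one_le_of_nonpos hN1 (by linarith))
  · rw [hVn, hNk]
    have e1 : t ≤ (5 * k) ^ 2 * (n : ℝ) ^ (2 * γ) * #𝓛 := hpt.trans (by gcongr)
    have e2 : (n : ℝ) ^ (-(ε + 2 * γ)) * (n : ℝ) ^ ((k : ℝ) - 1) * (n : ℝ) ^ (2 * γ) = t := by
      rw [← Real.rpow_add hN, ← Real.rpow_add hN, ht]
      congr 1
      ring
    have e3 : 0 < (5 * (k : ℝ)) ^ 2 * (n : ℝ) ^ (2 * γ) := by positivity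
    refine le_of_mul_le_mul_left (le_trans (le_of_eq ?_) e1) e3
    have e4 : (5 * (k : ℝ)) ^ 2 * (2 * a) = 1 := by rw [ha]; field_simp; norm_num
    calc _ = ((5 * (k : ℝ)) ^ 2 * (2 * a)) *
          ((n : ℝ) ^ (-(ε + 2 * γ)) * (n : ℝ) ^ ((k : ℝ) - 1) * (n : ℝ) ^ (2 * γ)) := by ring
      _ = t := by rw [e4, e2, one_mul]
  · rw [hVn]
    refine h3.trans (le_of_eq ?_)
    rw [mul_pow, ← Real.rpow_mul_natCast hN.le, mul_assoc]
    congr 1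
    rw [← Real.rpow_add_one hN.ne']
    congr 1
    ring

theorem eventually_rpow_le_mul_logb_logb_rpow (k : ℕ) {ε : ℝ} (hε : 0 < ε) {p : ℝ} (hp : 0 ≤ p) :
    ∀ᶠ n : ℕ in atTop, (n : ℝ) ^ ((k : ℝ) - 1 - ε) ≤
      (n : ℝ) ^ ((k : ℝ) - 1) * Real.logb 2 (Real.logb 2 n) ^ (-p) := by
  have hp4 : (0 : ℝ) < 1 / 4 ^ p := by positivity
  filter_upwards [tendsto_natCast_atTop_atTop.eventually
    ((isLittleO_log_rpow_rpow_atTop p hε).bound hp4), eventually_gt_atTop 2] with n h hn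
  have hN2 : (2 : ℝ) < n := by exact_mod_cast hn
  have hN : (0 : ℝ) < n := by linarith
  have hlog : 0 < Real.log n := Real.log_pos (by linarith)
  rw [Real.norm_of_nonneg (by positivity), Real.norm_of_nonneg (by positivity)] at h
  have hM : 1 < Real.logb 2 n := by
    rw [Real.lt_logb_iff_rpow_lt one_lt_two hN, Real.rpow_one]
    exact hN2
  set L := Real.logb 2 (Real.logb 2 n) with hL
  have hL0 : 0 < L := Real.logb_pos one_lt_two hM
  have hlog2 : (1 : ℝ) / 2 ≤ Real.log 2 := by linarith [Real.log_two_gt_d9]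
  have hhalf : ∀ y : ℝ, 0 ≤ y → y / Real.log 2 ≤ 2 * y := by
    intro y hy
    rw [div_le_iff₀ (by linarith)]
    nlinarith
  have hL4 : L ≤ 4 * Real.log n := by
    calc L ≤ Real.logb 2 n / Real.log 2 := by
          rw [hL, ← Real.log_div_log]
          gcongr
          exact Real.log_le_self (by linarith)
      _ ≤ 2 * Real.logb 2 n := hhalf _ (by linarith)
      _ ≤ 2 * (2 * Real.log n) := by gcongr; exact hhalf _ hlog.le
      _ = _ := by ring
  have hLp : L ^ p ≤ (n : ℝ) ^ ε := by
    calc L ^ p ≤ (4 * Real.log n) ^ p := by gcongr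
      _ = 4 ^ p * Real.log n ^ p := Real.mul_rpow (by norm_num) hlog.le
      _ ≤ 4 ^ p * (1 / 4 ^ p * (n : ℝ) ^ ε) := by gcongr
      _ = _ := by field_simp
  rw [sub_eq_add_neg _ ε, Real.rpow_add hN, Real.rpow_neg hN.le, Real.rpow_neg hL0.le]
  gcongr

end Extremal

/-! ### From hypergraphs to finite set families -/

section Transfer

variable {α : Type*}

theorem hasRegularSubgraph_of_hasRegularSubfamily [DecidableEq α] {H : Hypergraph α}
    {E : Finset (Finset α)} {r : ℕ} (hr : 1 ≤ r) (hE : ∀ e ∈ E, (e : Set α) ∈ H.edgeSet)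
    (h : HasRegularSubfamily E r) : H.HasRegularSubgraph r := by
  obtain ⟨F, hF, S, hSne, hdeg, hFS⟩ := h
  refine ⟨(fun e : Finset α => (e : Set α)) '' F, ?_, S, ?_, by exact_mod_cast hSne, ?_, ?_⟩
  · rintro _ ⟨e, he, rfl⟩
    exact hE e (hF he)
  · intro x hx
    obtain ⟨e, he⟩ : {e ∈ F | x ∈ e}.Nonempty := card_pos.1 (by rw [hdeg x hx]; exact hr)
    obtain ⟨he, hxe⟩ := mem_filter.1 he
    exact H.subset_vertexSet_of_mem_edgeSet (hE e (hF he)) hxe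
  · intro x hx
    have : {e ∈ (fun e : Finset α => (e : Set α)) '' F | x ∈ e} =
        (fun e : Finset α => (e : Set α)) '' ({e ∈ F | x ∈ e} : Finset (Finset α)) := by
      ext s
      constructor
      · rintro ⟨⟨e, he, rfl⟩, hxe⟩
        exact ⟨e, mem_coe.2 (mem_filter.2 ⟨he, hxe⟩), rfl⟩
      · rintro ⟨e, he, rfl⟩
        obtain ⟨he, hxe⟩ := mem_filter.1 (mem_coe.1 he)
        exact ⟨⟨e, he, rfl⟩, hxe⟩
    rw [this, coe_injective.encard_image, Set.encard_coe_eq_coe_finsetCard, hdeg x hx]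
  · rintro _ ⟨e, he, rfl⟩
    exact_mod_cast hFS e he

theorem exists_edgeFinset {H : Hypergraph α} {n : ℕ} (hn : H.vertexSet.encard = n) :
    ∃ (V : Finset α) (E : Finset (Finset α)), #V = n ∧ (∀ e ∈ E, e ⊆ V) ∧
      (∀ e ∈ E, (e : Set α) ∈ H.edgeSet) ∧ H.edgeSet.ncard = #E := by
  classical
  obtain ⟨V, hV⟩ := (Set.finite_of_encard_eq_coe hn).exists_finset_coe
  refine ⟨V, {e ∈ V.powerset | (e : Set α) ∈ H.edgeSet}, ?_, ?_, ?_, ?_⟩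
  · rw [← hV, Set.encard_coe_eq_coe_finsetCard] at hn
    exact_mod_cast hn
  · exact fun e he => mem_powerset.1 (mem_filter.1 he).1
  · exact fun e he => (mem_filter.1 he).2
  · rw [← Set.ncard_coe_finset, ← Set.ncard_image_of_injective _ (coe_injective (α := α))]
    congr 1
    ext s
    constructor
    · intro hs
      have hsV := H.subset_vertexSet_of_mem_edgeSet hs
      rw [← hV] at hsV
      obtain ⟨e, rfl⟩ := (V.finite_toSet.subset hsV).exists_finset_coe
      exact ⟨e, mem_coe.2 (mem_filter.2 ⟨mem_powerset.2 (by exact_mod_cast hsV), hs⟩), rfl⟩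
    · rintro ⟨e, he, rfl⟩
      exact (mem_filter.1 (mem_coe.1 he)).2

end Transfer

end RegularSubfamily

theorem theorem3p1 (k : ℕ) :
    ∃ n_k : ℕ, ∀ r ℓ : ℕ, 3 ≤ r → r < k → ℓ = ⌈Real.logb 2 r⌉₊ →
      ∀ n : ℕ, n_k ≤ n → ∀ (α : Type*) (H : Hypergraph α),
        H.vertexSet.encard = n → H.IsUniformOfSize k → ¬ H.HasRegularSubgraph r →
          (2 ^ (ℓ - 1) + 2 < k →
            (H.edgeSet.ncard : ℝ) ≤
              ((n - 1).choose (k - 1) : ℝ) +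
                3 * (n : ℝ) ^ ((k : ℝ) - 1 - 1 / (2 * (r : ℝ) ^ 2 - 2))) ∧
          (k = 2 ^ (ℓ - 1) + 2 →
            (H.edgeSet.ncard : ℝ) ≤
              ((n - 1).choose (k - 1) : ℝ) +
                3 * (n : ℝ) ^ ((k : ℝ) - 1) *
                  (Real.logb 2 (Real.logb 2 n)) ^ (-(1 / (4 * ((k : ℝ) - 1))))) := by
  classical
  have hev : ∀ᶠ n : ℕ in Filter.atTop, ∀ r ∈ Finset.range k, 3 ≤ r →
      (∀ (α : Type _) [DecidableEq α] (E : Finset (Finset α)) (V : Finset α),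
        V.card = n → (∀ e ∈ E, e.card = k) → (∀ e ∈ E, e ⊆ V) →
        ¬ RegularSubfamily.HasRegularSubfamily E r →
        (E.card : ℝ) ≤ ((n - 1).choose (k - 1) : ℝ) +
          3 * (n : ℝ) ^ ((k : ℝ) - 1 - 1 / (2 * (r : ℝ) ^ 2 - 2))) ∧
      (n : ℝ) ^ ((k : ℝ) - 1 - 1 / (2 * (r : ℝ) ^ 2 - 2)) ≤ (n : ℝ) ^ ((k : ℝ) - 1) *
        Real.logb 2 (Real.logb 2 n) ^ (-(1 / (4 * ((k : ℝ) - 1)))) := by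
    rw [Filter.eventually_all_finset]
    intro r hrk
    rw [Finset.mem_range] at hrk
    by_cases hr : 3 ≤ r
    · have hr3 : (3 : ℝ) ≤ r := by exact_mod_cast hr
      have hk4 : (4 : ℝ) ≤ k := by exact_mod_cast (show 4 ≤ k by omega)
      filter_upwards [RegularSubfamily.eventually_card_le_choose_add hr hrk,
        RegularSubfamily.eventually_rpow_le_mul_logb_logb_rpow k
          (ε := 1 / (2 * (r : ℝ) ^ 2 - 2)) (one_div_pos.2 (by nlinarith))
          (p := 1 / (4 * ((k : ℝ) - 1))) (one_div_nonneg.2 (by linarith))] with n h1 h2 _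
      exact ⟨h1, h2⟩
    · exact Filter.Eventually.of_forall fun n h => absurd h hr
  obtain ⟨N, hN⟩ := Filter.eventually_atTop.1 hev
  refine ⟨N, fun r ℓ hr hrk _ n hn α H hHn hHk hreg => ?_⟩
  obtain ⟨h1, h2⟩ := hN n hn r (Finset.mem_range.2 hrk) hr
  obtain ⟨V, E, hV, hEV, hE, hcard⟩ := RegularSubfamily.exists_edgeFinset hHn
  have hEk : ∀ e ∈ E, e.card = k := fun e he => by
    have := hHk e (hE e he)
    rw [Set.encard_coe_eq_coe_finsetCard] at this
    exact_mod_cast this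
  have hbound := h1 α E V hV hEk hEV fun h => hreg
    (RegularSubfamily.hasRegularSubgraph_of_hasRegularSubfamily (by omega) hE h)
  rw [hcard]
  refine ⟨fun _ => hbound, fun _ => hbound.trans ?_⟩
  rw [mul_assoc]
  gcongr
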